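/- Let $G$ be a finite group. The power graph $\mathcal{P}(G)$ is the simple undirected graph with vertex set $G$ in which two distinct elements $x,y$ are joined by an edge if and only if there exists a positive integer $m$ such that $x=y^m$ or $y=x^m$. The directed power graph $\vec{\mathcal{P}}(G)$ is the directed graph with vertex set $G$ and arc set $\{(x,y)\in G^2 : x\neq y,\ y=x^m \text{ for some positive integer } m\}$. Theorem (Cameron). If $G_1$ and $G_2$ are finite groups whose power graphs $\mathcal{P}(G_1)$ and $\mathcal{P}(G_2)$ are isomorphic as graphs, then their directed power graphs $\vec{\mathcal{P}}(G_1)$ and $\vec{\mathcal{P}}(G_2)$ are isomorphic as directed graphs. -/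

import Mathlib

/-- The power graph of a group `G`: the vertices are the elements of `G`, and two distinct elements
are joined by an edge when one of them is a positive power of the other. -/
def powerGraph (G : Type*) [Group G] : SimpleGraph G where
  Adj x y := x ≠ y ∧ ∃ m : ℕ, 0 < m ∧ (x = y ^ m ∨ y = x ^ m)
  symm := ⟨fun _ _ ⟨hne, m, hm, h⟩ => ⟨hne.symm, m, hm, h.symm⟩⟩
  loopless := ⟨fun _ h => h.1 rfl⟩

/-- The directed power graph of a group `G`: the vertices are the elements of `G`, and there is an
arc from `x` to `y` when `x ≠ y` and `y` is a positive power of `x`. -/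
def directedPowerGraph (G : Type*) [Group G] : Digraph G where
  Adj x y := x ≠ y ∧ ∃ m : ℕ, 0 < m ∧ y = x ^ m

/-- An isomorphism of digraphs: a bijection between the vertex sets that preserves and reflects
arcs, together with their directions. -/
abbrev DigraphIso {V W : Type*} (D : Digraph V) (E : Digraph W) :=
  RelIso D.Adj E.Adj

open Subgroup

/-! ### Subgroups and element orders inside a finite cyclic group. -/

section Cyclic

variable {G : Type*} [Group G]

/-! Adjacency or equality in the power graph is comparability for the preorder `x ∈ zpowers y`, so
an isomorphism respects comparability and twin classes. For comparable elements, divisibility of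
orders decides the direction, so it suffices to correct the isomorphism inside twin classes until it
preserves orders.

If some non-identity dominating element has order not a prime power, both groups are cyclic of the
same order (`nonempty_mulEquiv_of_not_primePowDominating`). Otherwise a twin class either consists
of generators of one cyclic group or lies in a cyclic group of prime power order
(`PowTwin.isPrimePow`), and it is convex for inclusion (`PowTwin.convex`). Away from the class of 1,
a lower class is never larger than one above it (`ncard_powTwin_le`); a tie forces orders `m` odd
and `2m`, and an involution settles it (`mem_zpowers_map`). Hence the graph determines the direction
between classes, and so the number of elements below each class. With the class size this gives the
number of its elements of each order (`ncard_powTwin_orderOf_eq`), so the correction exists. -/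

theorem mem_zpowers_trans {x y z : G} (hxy : x ∈ zpowers y) (hyz : y ∈ zpowers z) :
    x ∈ zpowers z :=
  zpowers_le.mpr hyz hxy

theorem ncard_zpowers (w : G) : (zpowers w : Set G).ncard = orderOf w := by
  rw [← Nat.card_zpowers, ← Nat.card_coe_set_eq]; rfl

variable [Finite G]

/-- A cyclic group has at most `n` solutions of `z ^ n = 1`; for `n = orderOf v`, the elements of
`⟨v⟩` already account for all of them. -/
theorem mem_zpowers_of_orderOf_dvd {u v w : G} (hu : u ∈ zpowers w) (hv : v ∈ zpowers w)
    (h : orderOf u ∣ orderOf v) : u ∈ zpowers v := by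
  classical
  have := Fintype.ofFinite G
  let T : Set (zpowers w) := {z | z ^ orderOf v = 1}
  let V : Set (zpowers w) := {z | (z : G) ∈ zpowers v}
  have hVT : V ⊆ T := fun z hz ↦ by
    have := orderOf_dvd_of_mem_zpowers hz
    simpa [T, Subtype.ext_iff] using orderOf_dvd_iff_pow_eq_one.mp this
  have hT : T.ncard ≤ orderOf v := by
    rw [Set.ncard_eq_toFinset_card']
    refine le_trans (le_of_eq ?_) (IsCyclic.card_pow_eq_one_le (α := zpowers w) (orderOf_pos v))
    congr 1; ext; simp [T]
  have hV : V.ncard = orderOf v := by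
    rw [← Nat.card_zpowers, ← Nat.card_coe_set_eq]
    refine Nat.card_congr ⟨fun z ↦ ⟨z.1.1, z.2⟩, fun z ↦ ⟨⟨z.1, ?_⟩, z.2⟩, fun _ ↦ rfl, fun _ ↦ rfl⟩
    exact (zpowers_le.mpr hv) z.2
  have hE := Set.eq_of_subset_of_ncard_le hVT (by omega)
  have : (⟨u, hu⟩ : zpowers w) ∈ T := by
    simpa [T, Subtype.ext_iff] using orderOf_dvd_iff_pow_eq_one.mp h
  rw [← hE] at this
  exact this

theorem mem_zpowers_symm_of_orderOf_eq {x y : G} (h : x ∈ zpowers y) (ho : orderOf x = orderOf y) :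
    y ∈ zpowers x :=
  mem_zpowers_of_orderOf_dvd (mem_zpowers y) h ho.symm.dvd

theorem exists_mem_zpowers_orderOf_eq (w : G) {d : ℕ} (hd : d ∣ orderOf w) :
    ∃ u ∈ zpowers w, orderOf u = d := by
  obtain ⟨k, hk⟩ := hd
  have hpos := orderOf_pos w
  have hk0 : k ≠ 0 := by rintro rfl; simp [hk] at hpos
  refine ⟨w ^ k, npow_mem_zpowers w k, ?_⟩
  rw [orderOf_pow_of_dvd hk0 (hk ▸ Dvd.intro_left d rfl), hk,
    Nat.mul_div_cancel _ (Nat.pos_of_ne_zero hk0)]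

theorem ncard_orderOf_eq_of_mem_zpowers (w : G) {d : ℕ} (hd : d ∣ orderOf w) :
    {y | y ∈ zpowers w ∧ orderOf y = d}.ncard = d.totient := by
  classical
  have := Fintype.ofFinite G
  rw [← Nat.card_zpowers, Nat.card_eq_fintype_card] at hd
  rw [← IsCyclic.card_orderOf_eq_totient hd, ← Set.ncard_coe_finset,
    ← Set.ncard_image_of_injective _ (Subtype.val_injective (p := fun y ↦ y ∈ zpowers w))]
  congr 1
  ext y
  constructor
  · rintro ⟨hy, ho⟩
    exact ⟨⟨y, hy⟩, by simpa using ho, rfl⟩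
  · rintro ⟨⟨y, hy⟩, ho, rfl⟩
    exact ⟨hy, by simpa using ho⟩

end Cyclic

/-- Two elements of a group are comparable when one of them lies in the cyclic subgroup generated
by the other. -/
def PowComparable {G : Type*} [Group G] (x y : G) : Prop :=
  x ∈ zpowers y ∨ y ∈ zpowers x

/-- Two elements are twins when they are comparable with the same elements, that is, when they have
the same closed neighbourhood in the power graph. -/
def PowTwin {G : Type*} [Group G] (x y : G) : Prop :=
  ∀ z, PowComparable x z ↔ PowComparable y z

/-- A non-identity element comparable with every element has prime power order. -/
def PrimePowDominating (G : Type*) [Group G] : Prop :=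
  ∀ x : G, x ≠ 1 → PowTwin x 1 → IsPrimePow (orderOf x)

/-! ### Comparability and the structure of twin classes. -/

section Comparable

variable {G : Type*} [Group G]

theorem PowComparable.refl (x : G) : PowComparable x x := Or.inl (mem_zpowers x)

theorem PowComparable.symm {x y : G} (h : PowComparable x y) : PowComparable y x := Or.symm h

theorem powComparable_one (x : G) : PowComparable 1 x := Or.inl (one_mem _)

theorem PowTwin.refl (x : G) : PowTwin x x := fun _ ↦ Iff.rfl

theorem PowTwin.symm {x y : G} (h : PowTwin x y) : PowTwin y x := fun z ↦ (h z).symm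

theorem PowTwin.trans {x y z : G} (h : PowTwin x y) (h' : PowTwin y z) : PowTwin x z :=
  fun w ↦ (h w).trans (h' w)

theorem PowTwin.comparable {x y : G} (h : PowTwin x y) : PowComparable x y :=
  (h y).mpr (.refl y)

theorem powTwin_one_iff {x : G} : PowTwin x 1 ↔ ∀ z, PowComparable x z :=
  ⟨fun h z ↦ (h z).mpr (powComparable_one z), fun h z ↦ iff_of_true (h z) (powComparable_one z)⟩

theorem PowTwin.of_zpowers_eq {x y : G} (h : x ∈ zpowers y) (h' : y ∈ zpowers x) : PowTwin x y := by
  have : zpowers x = zpowers y := le_antisymm (zpowers_le.mpr h) (zpowers_le.mpr h')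
  intro z
  unfold PowComparable
  rw [← zpowers_le, this, zpowers_le]

variable [Finite G]

theorem PowComparable.mem_zpowers_of_dvd {x y : G} (h : PowComparable x y)
    (ho : orderOf x ∣ orderOf y) : x ∈ zpowers y := by
  rcases h with h | h
  · exact h
  · exact mem_zpowers_of_orderOf_dvd (mem_zpowers x) h ho

theorem powComparable_iff_dvd {u v w : G} (hu : u ∈ zpowers w) (hv : v ∈ zpowers w) :
    PowComparable u v ↔ orderOf u ∣ orderOf v ∨ orderOf v ∣ orderOf u :=
  ⟨Or.imp orderOf_dvd_of_mem_zpowers orderOf_dvd_of_mem_zpowers,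
    Or.imp (mem_zpowers_of_orderOf_dvd hu hv) (mem_zpowers_of_orderOf_dvd hv hu)⟩

theorem powComparable_of_isPrimePow {u v w : G} (hu : u ∈ zpowers w) (hv : v ∈ zpowers w)
    (hw : IsPrimePow (orderOf w)) : PowComparable u v := by
  obtain ⟨p, k, hp, -, hpk⟩ := hw
  rw [powComparable_iff_dvd hu hv]
  obtain ⟨i, -, hi⟩ := (Nat.dvd_prime_pow hp.nat_prime).mp
    (hpk ▸ orderOf_dvd_of_mem_zpowers hu)
  obtain ⟨j, -, hj⟩ := (Nat.dvd_prime_pow hp.nat_prime).mp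
    (hpk ▸ orderOf_dvd_of_mem_zpowers hv)
  rw [hi, hj]
  exact (le_total i j).imp (pow_dvd_pow p) (pow_dvd_pow p)

/-- If `x` is comparable with every element of the cyclic group generated by `y` and the prime `p`
divides the index of `⟨x⟩` in `⟨y⟩`, then `x` has order a power of `p`. -/
theorem exists_orderOf_eq_prime_pow {x y : G} {p k : ℕ} (hp : p.Prime) (hx : x ∈ zpowers y)
    (hk : orderOf y = orderOf x * k) (hpk : p ∣ k)
    (h : ∀ w ∈ zpowers y, PowComparable x w) : ∃ a, orderOf x = p ^ a := by
  have hy0 := (orderOf_pos y).ne'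
  have hx0 := (orderOf_pos x).ne'
  -- `w` generates the Sylow `p`-subgroup of `⟨y⟩`; as `p` divides the index, its order cannot
  -- divide that of `x`.
  obtain ⟨w, hw, hwo⟩ := exists_mem_zpowers_orderOf_eq y (Nat.ordProj_dvd (orderOf y) p)
  rcases (powComparable_iff_dvd hx hw).mp (h w hw) with h1 | h1
  · rw [hwo] at h1
    obtain ⟨a, -, ha⟩ := (Nat.dvd_prime_pow hp).mp h1
    exact ⟨a, ha⟩
  · exfalso
    rw [hwo, hp.pow_dvd_iff_le_factorization hx0, hk] at h1
    have hk0 : k ≠ 0 := by rintro rfl; simp [hk] at hy0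
    rw [Nat.factorization_mul hx0 hk0] at h1
    have := (hp.dvd_iff_one_le_factorization hk0).mp hpk
    simp at h1
    omega

theorem exists_orderOf_eq_mul {x y : G} (hx : x ∈ zpowers y) (hy : y ∉ zpowers x) :
    ∃ k, orderOf y = orderOf x * k ∧ k ≠ 1 := by
  obtain ⟨k, hk⟩ := orderOf_dvd_of_mem_zpowers hx
  refine ⟨k, hk, ?_⟩
  rintro rfl
  exact hy (mem_zpowers_symm_of_orderOf_eq hx (by omega))

/-- The prime power dichotomy: strictly nested twins generate groups of prime power order. -/
theorem PowTwin.isPrimePow {x y : G} (hG : PrimePowDominating G) (h : PowTwin x y)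
    (hx : x ∈ zpowers y) (hy : y ∉ zpowers x) : IsPrimePow (orderOf y) := by
  by_cases h1 : x = 1
  · subst h1
    exact hG y (by rintro rfl; exact hy hx) h.symm
  obtain ⟨k, hk, hk1⟩ := exists_orderOf_eq_mul hx hy
  have hcomp : ∀ w ∈ zpowers y, PowComparable x w := fun w hw ↦ (h w).mpr (Or.inr hw)
  obtain ⟨p, hp, hpk⟩ := Nat.exists_prime_and_dvd hk1
  obtain ⟨a, ha⟩ := exists_orderOf_eq_prime_pow hp hx hk hpk hcomp
  have ha0 : a ≠ 0 := by
    rintro rfl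
    exact h1 (orderOf_eq_one_iff.mp (by simpa using ha))
  -- Any prime `q` dividing `k` makes `orderOf x` a power of `q` too, and `x ≠ 1`, so `q = p`.
  have hkp : k = p ^ k.primeFactorsList.length := by
    refine Nat.eq_prime_pow_of_unique_prime_dvd ?_ ?_
    · rintro rfl; exact (orderOf_pos y).ne' (by simp [hk])
    · intro q hq hqk
      obtain ⟨b, hb⟩ := exists_orderOf_eq_prime_pow hq hx hk hqk hcomp
      have : p ∣ q ^ b := by rw [← hb, ha]; exact dvd_pow_self p ha0
      exact ((Nat.prime_dvd_prime_iff_eq hp hq).mp (hp.dvd_of_dvd_pow this)).symm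
  rw [hk, ha, hkp, ← pow_add]
  exact hp.isPrimePow.pow (by omega)

/-- Twin classes are convex for inclusion of cyclic subgroups. -/
theorem PowTwin.convex {x y z : G} (hG : PrimePowDominating G) (h : PowTwin z x)
    (hzy : z ∈ zpowers y) (hyx : y ∈ zpowers x) : PowTwin y x := by
  by_cases hxz : x ∈ zpowers z
  · exact .of_zpowers_eq hyx (mem_zpowers_trans hxz hzy)
  have hpp := h.isPrimePow hG (mem_zpowers_trans hzy hyx) hxz
  refine PowTwin.trans (fun u ↦ ⟨fun hu ↦ ?_, fun hu ↦ ?_⟩) h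
  · rcases hu with hu | hu
    · exact Or.inl (mem_zpowers_trans hzy hu)
    · exact (h u).mpr (Or.inr (mem_zpowers_trans hu hyx))
  · rcases (h u).mp hu with hu | hu
    · exact Or.inl (mem_zpowers_trans hyx hu)
    · exact powComparable_of_isPrimePow hyx hu hpp

/-- Every twin class has an element whose cyclic group contains the class. -/
theorem exists_powTwin_forall_mem_zpowers (x : G) :
    ∃ t, PowTwin t x ∧ ∀ y, PowTwin y x → y ∈ zpowers t := by
  obtain ⟨t, ht, hmax⟩ := Set.exists_max_image {t | PowTwin t x} orderOf (Set.toFinite _)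
    ⟨x, .refl x⟩
  refine ⟨t, ht, fun y hy ↦ ?_⟩
  rcases (PowTwin.trans hy ht.symm).comparable with h | h
  · exact h
  · have := Nat.le_of_dvd (orderOf_pos y) (orderOf_dvd_of_mem_zpowers h)
    exact mem_zpowers_symm_of_orderOf_eq h (le_antisymm this (hmax y hy))

/-- Generators of the same cyclic group are twins. -/
theorem totient_orderOf_le_ncard_powTwin (x : G) :
    (orderOf x).totient ≤ {y | PowTwin y x}.ncard := by
  rw [← ncard_orderOf_eq_of_mem_zpowers x dvd_rfl]
  exact Set.ncard_le_ncard fun y hy ↦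
    .of_zpowers_eq hy.1 (mem_zpowers_symm_of_orderOf_eq hy.1 hy.2)

end Comparable

/-! ### Sizes of twin classes and the orders occurring in them. -/

section Group

variable {G : Type*} [Group G] [Finite G]

/-- A twin class that is not dominating has at most as many elements as one above it; equality
forces the orders to be an odd number and its double. -/
theorem ncard_powTwin_le {x y : G} (hG : PrimePowDominating G) (hyx : y ∈ zpowers x)
    (hxy : ¬ PowTwin y x) (hy1 : ¬ PowTwin y 1) :
    {z | PowTwin z y}.ncard ≤ {z | PowTwin z x}.ncard ∧
      ({z | PowTwin z y}.ncard = {z | PowTwin z x}.ncard →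
        orderOf x = 2 * orderOf y ∧ Odd (orderOf y)) := by
  have hφx := totient_orderOf_le_ncard_powTwin x
  have hdvd := orderOf_dvd_of_mem_zpowers hyx
  -- Either every twin of `y` generates `⟨y⟩`, and totients are compared, or the class contains a
  -- strictly nested pair, and its top `t` has prime power order.
  by_cases hcl : ∀ z, PowTwin z y → y ∈ zpowers z ∧ z ∈ zpowers y
  · have hφy : {z | PowTwin z y}.ncard ≤ (orderOf y).totient := by
      rw [← ncard_orderOf_eq_of_mem_zpowers y dvd_rfl]
      refine Set.ncard_le_ncard fun z hz ↦ ⟨(hcl z hz).2, ?_⟩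
      exact Nat.dvd_antisymm (orderOf_dvd_of_mem_zpowers (hcl z hz).2)
        (orderOf_dvd_of_mem_zpowers (hcl z hz).1)
    have hle : (orderOf y).totient ≤ (orderOf x).totient :=
      Nat.le_of_dvd (Nat.totient_pos.mpr (orderOf_pos x)) (Nat.totient_dvd_of_dvd hdvd)
    refine ⟨by omega, fun heq ↦ ?_⟩
    rcases Nat.eq_or_eq_of_totient_eq_totient hdvd (by omega) with h | h
    · exact absurd (.of_zpowers_eq hyx (mem_zpowers_symm_of_orderOf_eq hyx h)) hxy
    · refine ⟨h.symm, ?_⟩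
      by_contra hodd
      have h2 := Nat.totient_two_mul_of_even (Nat.not_odd_iff_even.mp hodd)
      rw [h] at h2
      have := Nat.totient_pos.mpr (orderOf_pos y)
      omega
  · suffices h : {z | PowTwin z y}.ncard < {z | PowTwin z x}.ncard from ⟨h.le, fun h' ↦ by omega⟩
    obtain ⟨t, hty, ht⟩ := exists_powTwin_forall_mem_zpowers y
    obtain ⟨b, hby, htb⟩ : ∃ b, PowTwin b y ∧ t ∉ zpowers b := by
      by_contra! hcon
      exact hcl fun z hz ↦ ⟨mem_zpowers_trans (ht y (.refl y)) (hcon z hz),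
        mem_zpowers_trans (ht z hz) (hcon y (.refl y))⟩
    have hbt := hby.trans hty.symm
    have htx : t ∈ zpowers x := by
      rcases (hty x).mpr (Or.inl hyx) with h | h
      · exact h
      · exact absurd ((hty.symm.convex hG hyx h).trans hty).symm hxy
    have hxt : x ∉ zpowers t := fun h ↦ hxy (hty.symm.trans (.of_zpowers_eq htx h))
    obtain ⟨p, s, hp, hs, hps⟩ := hbt.isPrimePow hG (ht b hby) htb
    replace hp := hp.nat_prime
    obtain ⟨k, hk, hk1⟩ := exists_orderOf_eq_mul htx hxt
    obtain ⟨q, hq, hqk⟩ := Nat.exists_prime_and_dvd hk1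
    have hbo := orderOf_dvd_of_mem_zpowers (ht b hby)
    have hqp : q = p := by
      by_contra hqp
      have hcop : Nat.Coprime (orderOf t) q := by
        rw [← hps]
        exact ((Nat.coprime_primes hp hq).mpr (Ne.symm hqp)).pow_left s
      -- With `q ≠ p`, this `u` would be comparable with `b` but not with its twin `t`.
      obtain ⟨u, hu, huo⟩ := exists_mem_zpowers_orderOf_eq x (d := orderOf b * q)
        (hk ▸ mul_dvd_mul hbo hqk)
      have hbu : PowComparable b u :=
        (powComparable_iff_dvd (mem_zpowers_trans (ht b hby) htx) hu).mpr
          (Or.inl (huo ▸ dvd_mul_right _ _))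
      rcases (powComparable_iff_dvd htx hu).mp ((hbt u).mp hbu) with h | h
      · rw [huo] at h
        have := Nat.dvd_antisymm hbo (hcop.dvd_of_dvd_mul_right h)
        exact htb (mem_zpowers_symm_of_orderOf_eq (ht b hby) this)
      · have : q ∣ 1 := by
          rw [← hcop.symm.gcd_eq_one]
          exact Nat.dvd_gcd dvd_rfl ((huo ▸ dvd_mul_left q _).trans h)
        exact hq.one_lt.ne' (Nat.dvd_one.mp this)
    subst hqp
    have h1 : {z | PowTwin z y}.ncard < orderOf t := by
      rw [← ncard_zpowers t]
      refine Set.ncard_lt_ncard ⟨fun z hz ↦ ht z hz, fun h ↦ hy1 ?_⟩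
      exact (h (one_mem (zpowers t))).symm
    -- Here `φ(q^(s+1)) = q^s (q - 1) ≥ q^s = orderOf t`.
    have h2 : orderOf t ≤ (orderOf x).totient := by
      have hd : q ^ (s + 1) ∣ orderOf x := by
        rw [hk, pow_succ, hps]; exact mul_dvd_mul_left _ hqk
      refine le_trans ?_ (Nat.le_of_dvd (Nat.totient_pos.mpr (orderOf_pos x))
        (Nat.totient_dvd_of_dvd hd))
      rw [Nat.totient_prime_pow_succ hq, hps]
      exact Nat.le_mul_of_pos_right _ (by have := hq.one_lt; omega)
    omega

/-- The number of elements of each order in a twin class is determined by the size of the class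
and the number of elements strictly below it. -/
theorem ncard_powTwin_orderOf_eq (hG : PrimePowDominating G) (x : G) (n : ℕ) :
    {y | PowTwin y x ∧ orderOf y = n}.ncard =
      if n ∣ {y | ¬ PowTwin y x ∧ y ∈ zpowers x}.ncard + {y | PowTwin y x}.ncard ∧
        {y | ¬ PowTwin y x ∧ y ∈ zpowers x}.ncard < n then n.totient else 0 := by
  obtain ⟨t, htx, ht⟩ := exists_powTwin_forall_mem_zpowers x
  have hB : {y | ¬ PowTwin y x ∧ y ∈ zpowers x} = {y | ¬ PowTwin y x ∧ y ∈ zpowers t} := by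
    ext y
    refine and_congr_right fun hy ↦ ⟨fun h ↦ mem_zpowers_trans h (ht x (.refl x)), fun h ↦ ?_⟩
    rcases (htx y).mp (Or.inr h) with h' | h'
    · exact absurd ((htx.symm.convex hG h' h).trans htx) hy
    · exact h'
  rw [hB]
  set B := {y | ¬ PowTwin y x ∧ y ∈ zpowers t} with hBdef
  have hM : B.ncard + {y | PowTwin y x}.ncard = orderOf t := by
    rw [← ncard_zpowers t, ← Set.ncard_union_eq]
    · congr 1
      ext y
      by_cases hy : PowTwin y x
      · simpa [hBdef, hy] using ht y hy
      · simp [hBdef, hy]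
    · rw [Set.disjoint_left]
      exact fun y hy hy' ↦ hy.1 hy'
  -- A twin `y` generates a group containing `B` strictly; a non-twin `y` in `⟨t⟩` generates a group
  -- inside `B`. Both use convexity.
  have key : ∀ y ∈ zpowers t, (PowTwin y x ↔ B.ncard < orderOf y) := by
    intro y hy
    constructor
    · intro hyx
      rw [← ncard_zpowers y]
      refine Set.ncard_lt_ncard ⟨fun w hw ↦ ?_, fun h ↦ (h (mem_zpowers y)).1 hyx⟩
      rcases ((hyx.trans htx.symm) w).mpr (Or.inr hw.2) with h | h
      · exact absurd (((hyx.trans htx.symm).convex hG h hw.2).trans htx) hw.1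
      · exact h
    · intro hlt
      by_contra hyx
      refine hlt.not_ge ?_
      rw [← ncard_zpowers y]
      refine Set.ncard_le_ncard fun w hw ↦ ⟨fun hwx ↦ hyx ?_, mem_zpowers_trans hw hy⟩
      exact ((hwx.trans htx.symm).convex hG hw hy).trans htx
  rw [hM]
  split_ifs with h
  · rw [← ncard_orderOf_eq_of_mem_zpowers t h.1]
    congr 1
    ext y
    refine and_congr_left fun ho ↦ ⟨fun hy ↦ ht y hy, fun hy ↦ (key y hy).mpr (ho ▸ h.2)⟩
  · rw [Set.ncard_eq_zero, Set.eq_empty_iff_forall_notMem]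
    rintro y ⟨hy, rfl⟩
    exact h ⟨orderOf_dvd_of_mem_zpowers (ht y hy), (key y (ht y hy)).mp hy⟩

theorem PowTwin.mem_zpowers_of_one {x y : G} (hG : PrimePowDominating G) (hy : PowTwin y 1)
    (hx : ¬ PowTwin x 1) : y ∈ zpowers x :=
  (powTwin_one_iff.mp hy x).resolve_right fun h ↦
    hx ((hy.symm.convex hG (one_mem _) h).trans hy)

/-- An involution below an element of even order `2m`, with `m > 1` odd, is alone in its class. -/
theorem powTwin_involution {x t z : G} (hG : PrimePowDominating G) (htx : t ∈ zpowers x)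
    (ht : orderOf t = 2) (ht1 : ¬ PowTwin t 1) {m : ℕ} (hm : Odd m) (hm1 : m ≠ 1)
    (hx : orderOf x = 2 * m) (hz : PowTwin z t) : z = t := by
  have hmem : ∀ u ∈ zpowers t, u = 1 ∨ u = t := by
    rintro u ⟨i, rfl⟩
    have h2 : t ^ 2 = 1 := ht ▸ pow_orderOf_eq_one t
    rcases Int.even_or_odd' i with ⟨j, rfl | rfl⟩
    · left; simp only [zpow_mul]; norm_cast; simp [h2]
    · right; simp only [zpow_add, zpow_mul]; norm_cast; simp [h2]
  rcases hz.comparable with h | h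
  · rcases hmem z h with rfl | h
    · exact absurd hz.symm ht1
    · exact h
  by_cases hzt : z ∈ zpowers t
  · rcases hmem z hzt with rfl | h
    · exact absurd hz.symm ht1
    · exact h
  exfalso
  obtain ⟨p, s, hp, hs, hps⟩ := hz.symm.isPrimePow hG h hzt
  replace hp := hp.nat_prime
  have h2 : 2 ∣ p ^ s := by
    rw [hps, ← ht]; exact orderOf_dvd_of_mem_zpowers h
  obtain rfl := (Nat.prime_dvd_prime_iff_eq Nat.prime_two hp).mp (Nat.prime_two.dvd_of_dvd_pow h2)
  -- A further twin `z` has order `2^s` with `s ≥ 2`, and must be comparable with `x`, of order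
  -- `2m`: neither order divides the other.
  rcases (hz x).mpr (Or.inl htx) with h' | h'
  · have h4 : 2 ^ 2 ∣ orderOf z := by
      rw [← hps]
      refine pow_dvd_pow 2 ?_
      by_contra hs2
      obtain rfl : s = 1 := by omega
      exact hzt (mem_zpowers_symm_of_orderOf_eq h (by omega))
    have := h4.trans (orderOf_dvd_of_mem_zpowers h')
    rw [hx] at this
    obtain ⟨j, rfl⟩ := hm
    omega
  · have hd := orderOf_dvd_of_mem_zpowers h'
    rw [hx, ← hps] at hd
    have := (Nat.Coprime.pow_right s hm.coprime_two_right).eq_one_of_dvd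
      ((dvd_mul_left m 2).trans hd)
    exact hm1 this

end Group

/-! ### Transfer along a comparability-preserving bijection. -/

section Transfer

theorem ncard_setOf_comp_equiv {α β : Type*} (f : α ≃ β) (P : β → Prop) :
    {x | P (f x)}.ncard = {y | P y}.ncard := by
  rw [← Nat.card_coe_set_eq, ← Nat.card_coe_set_eq]
  exact Nat.card_congr (f.subtypeEquiv fun _ ↦ Iff.rfl)

variable {G H : Type*} [Group G] [Group H]

/-- A bijection between groups that preserves comparability also preserves twins. -/
theorem powTwin_map_iff (f : G ≃ H) (hf : ∀ x y, PowComparable (f x) (f y) ↔ PowComparable x y)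
    {x y : G} : PowTwin (f x) (f y) ↔ PowTwin x y := by
  unfold PowTwin
  rw [f.surjective.forall]
  simp only [hf]

theorem powTwin_map_one_iff (f : G ≃ H)
    (hf : ∀ x y, PowComparable (f x) (f y) ↔ PowComparable x y) {x : G} :
    PowTwin (f x) 1 ↔ PowTwin x 1 := by
  rw [powTwin_one_iff, powTwin_one_iff, f.surjective.forall]
  simp only [hf]

theorem ncard_powTwin_map (f : G ≃ H)
    (hf : ∀ x y, PowComparable (f x) (f y) ↔ PowComparable x y) (x : G) :
    {z | PowTwin z (f x)}.ncard = {z | PowTwin z x}.ncard := by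
  rw [← ncard_setOf_comp_equiv f]
  simp only [powTwin_map_iff f hf]

variable [Finite G] [Finite H]

/-- Between distinct twin classes, a comparability-preserving bijection preserves direction. -/
theorem mem_zpowers_map (hG : PrimePowDominating G) (hH : PrimePowDominating H) (f : G ≃ H)
    (hf : ∀ x y, PowComparable (f x) (f y) ↔ PowComparable x y) {x y : G}
    (hyx : y ∈ zpowers x) (hne : ¬ PowTwin y x) : f y ∈ zpowers (f x) := by
  by_contra hcon
  have hfxy : f x ∈ zpowers (f y) := ((hf y x).mpr (Or.inl hyx)).resolve_left hcon
  have hx1 : ¬ PowTwin x 1 := fun h ↦ hne ((h.symm.convex hG (one_mem _) hyx))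
  have hy1 : ¬ PowTwin y 1 := fun h ↦ hcon <|
    ((powTwin_map_one_iff f hf).mpr h).mem_zpowers_of_one hH (mt (powTwin_map_one_iff f hf).mp hx1)
  have h1 := ncard_powTwin_le hG hyx hne hy1
  have h2 := ncard_powTwin_le hH hfxy (fun h ↦ hne ((powTwin_map_iff f hf).mp h).symm)
    (mt (powTwin_map_one_iff f hf).mp hx1)
  rw [ncard_powTwin_map f hf, ncard_powTwin_map f hf] at h2
  have heq := le_antisymm h1.1 h2.1
  obtain ⟨hox, hoddy⟩ := h1.2 heq
  obtain ⟨-, hoddx⟩ := h2.2 heq.symm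
  -- The involution of `⟨x⟩` breaks the tie: alone in its class, it is sent to an element of order 1
  -- or 2. Order 1 would make `t` comparable with `y`; order 2 conflicts with `f x` being
  -- non-dominating of odd order.
  obtain ⟨t, htx, hto⟩ := exists_mem_zpowers_orderOf_eq x (hox ▸ dvd_mul_right 2 _)
  have hoy1 : orderOf y ≠ 1 := fun h ↦ hy1 (orderOf_eq_one_iff.mp h ▸ .refl _)
  have hty : ¬ PowComparable t y := by
    rintro (h | h)
    · have := orderOf_dvd_of_mem_zpowers h
      rw [hto] at this
      exact Nat.not_even_iff_odd.mpr hoddy (even_iff_two_dvd.mpr this)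
    · have := orderOf_dvd_of_mem_zpowers h
      rw [hto] at this
      rcases (Nat.dvd_prime Nat.prime_two).mp this with h | h
      · exact hoy1 h
      · rw [h] at hoddy; exact absurd hoddy (by decide)
  have ht1 : ¬ PowTwin t 1 := fun h ↦ hty (powTwin_one_iff.mp h y)
  have hcard : {z | PowTwin z t} = {t} := by
    ext z
    exact ⟨powTwin_involution hG htx hto ht1 hoddy hoy1 hox, by rintro rfl; exact .refl z⟩
  have hft := totient_orderOf_le_ncard_powTwin (f t)
  rw [ncard_powTwin_map f hf, hcard, Set.ncard_singleton] at hft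
  have := Nat.totient_pos.mpr (orderOf_pos (f t))
  rcases Nat.totient_eq_one_iff.mp (le_antisymm hft this) with h | h
  · rw [orderOf_eq_one_iff] at h
    exact hty ((hf t y).mp (h ▸ powComparable_one _))
  · rcases (hf t x).mpr (Or.inl htx) with h' | h'
    · have := orderOf_dvd_of_mem_zpowers h'
      rw [h] at this
      exact Nat.not_even_iff_odd.mpr hoddx (even_iff_two_dvd.mpr this)
    · have := orderOf_dvd_of_mem_zpowers h'
      rw [h] at this
      rcases (Nat.dvd_prime Nat.prime_two).mp this with h | h
      · exact hx1 ((powTwin_map_one_iff f hf).mp (orderOf_eq_one_iff.mp h ▸ .refl _))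
      · rw [h] at hoddx; exact absurd hoddx (by decide)

theorem ncard_powTwin_orderOf_map (hG : PrimePowDominating G) (hH : PrimePowDominating H)
    (f : G ≃ H) (hf : ∀ x y, PowComparable (f x) (f y) ↔ PowComparable x y) (x : G) (n : ℕ) :
    {y | PowTwin y x ∧ orderOf y = n}.ncard = {y | PowTwin y (f x) ∧ orderOf y = n}.ncard := by
  rw [ncard_powTwin_orderOf_eq hG, ncard_powTwin_orderOf_eq hH, ncard_powTwin_map f hf,
    ← ncard_setOf_comp_equiv f (fun y ↦ ¬ PowTwin y (f x) ∧ y ∈ zpowers (f x))]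
  have : {y | ¬ PowTwin y x ∧ y ∈ zpowers x} =
      {y | ¬ PowTwin (f y) (f x) ∧ f y ∈ zpowers (f x)} := by
    ext y
    simp only [Set.mem_ofPred_eq, powTwin_map_iff f hf]
    refine and_congr_right fun hne ↦ ⟨fun h ↦ mem_zpowers_map hG hH f hf h hne, fun h ↦ ?_⟩
    have hf' : ∀ x y, PowComparable (f.symm x) (f.symm y) ↔ PowComparable x y := fun x y ↦ by
      rw [← hf]; simp
    simpa using mem_zpowers_map hH hG f.symm hf' h (by rwa [powTwin_map_iff f hf])
  rw [this]

/-- A comparability-preserving bijection can be corrected within twin classes so that it preserves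
inclusion of cyclic subgroups. -/
theorem exists_equiv_mem_zpowers_iff (hG : PrimePowDominating G) (hH : PrimePowDominating H)
    (f : G ≃ H) (hf : ∀ x y, PowComparable (f x) (f y) ↔ PowComparable x y) :
    ∃ g : G ≃ H, ∀ x y, g x ∈ zpowers (g y) ↔ x ∈ zpowers y := by
  -- A fibre fixes a twin class of `H` and an order, so a bijection matching the fibres of `a` and
  -- `b` moves `f x` only within its class and preserves orders.
  let a : G → Set H × ℕ := fun x ↦ ({z | PowTwin (f x) z}, orderOf x)
  let b : H → Set H × ℕ := fun y ↦ ({z | PowTwin y z}, orderOf y)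
  have hset : ∀ u v : H, {z | PowTwin u z} = {z | PowTwin v z} ↔ PowTwin u v := fun u v ↦ by
    refine ⟨fun h ↦ ?_, fun h ↦ ?_⟩
    · have : v ∈ {z | PowTwin u z} := h ▸ PowTwin.refl v
      exact this
    · ext z; exact ⟨h.symm.trans, h.trans⟩
  have hcard : ∀ c, Nonempty ({x // a x = c} ≃ {y // b y = c}) := by
    rintro ⟨s, n⟩
    by_cases hs : ∃ x, {z | PowTwin (f x) z} = s
    · obtain ⟨x, rfl⟩ := hs
      have h1 : {y | a y = ({z | PowTwin (f x) z}, n)} = {y | PowTwin y x ∧ orderOf y = n} := by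
        ext y; simp [a, Prod.ext_iff, hset, powTwin_map_iff f hf]
      have h2 : {y | b y = ({z | PowTwin (f x) z}, n)} =
          {y | PowTwin y (f x) ∧ orderOf y = n} := by
        ext y; simp [b, Prod.ext_iff, hset]
      have h := ncard_powTwin_orderOf_map hG hH f hf x n
      rw [← h1, ← h2, ← Nat.card_coe_set_eq, ← Nat.card_coe_set_eq] at h
      exact Finite.card_eq.mp h
    · have h1 : IsEmpty {x // a x = (s, n)} := ⟨fun x ↦ hs ⟨x.1, congrArg Prod.fst x.2⟩⟩
      have h2 : IsEmpty {y // b y = (s, n)} :=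
        ⟨fun y ↦ hs ⟨f.symm y.1, by simpa using congrArg Prod.fst y.2⟩⟩
      exact ⟨Equiv.equivOfIsEmpty _ _⟩
  let e := fun c ↦ (hcard c).some
  let g : G ≃ H := Equiv.ofFiberEquiv e
  have hg : ∀ x, b (g x) = a x := Equiv.ofFiberEquiv_map e
  have htw : ∀ x, PowTwin (g x) (f x) := fun x ↦ (hset _ _).mp (congrArg Prod.fst (hg x))
  have hord : ∀ x, orderOf (g x) = orderOf x := fun x ↦ congrArg Prod.snd (hg x)
  have hcomp : ∀ x y, PowComparable (g x) (g y) ↔ PowComparable x y := fun x y ↦ by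
    rw [htw x, ← hf x y]
    exact ⟨fun h ↦ ((htw y _).mp h.symm).symm, fun h ↦ ((htw y _).mpr h.symm).symm⟩
  refine ⟨g, fun x y ↦ ⟨fun h ↦ ?_, fun h ↦ ?_⟩⟩
  · exact ((hcomp x y).mp (Or.inl h)).mem_zpowers_of_dvd
      (by simpa only [hord] using orderOf_dvd_of_mem_zpowers h)
  · exact ((hcomp x y).mpr (Or.inl h)).mem_zpowers_of_dvd
      (by simpa only [hord] using orderOf_dvd_of_mem_zpowers h)

/-- If a dominating non-identity element does not have prime power order, it generates the group. -/
theorem PowTwin.mem_zpowers_of_not_isPrimePow {x : G} (hx1 : x ≠ 1) (hx : PowTwin x 1)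
    (hpp : ¬ IsPrimePow (orderOf x)) (z : G) : z ∈ zpowers x := by
  by_contra hz
  have hxz := (powTwin_one_iff.mp hx z).resolve_right hz
  obtain ⟨k, hk, hk1⟩ := exists_orderOf_eq_mul hxz hz
  obtain ⟨p, hp, hpk⟩ := Nat.exists_prime_and_dvd hk1
  obtain ⟨a, ha⟩ := exists_orderOf_eq_prime_pow hp hxz hk hpk fun w _ ↦ powTwin_one_iff.mp hx w
  refine hpp (ha ▸ hp.isPrimePow.pow ?_)
  rintro rfl
  exact hx1 (orderOf_eq_one_iff.mp (by simpa using ha))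

/-- A dominating non-identity element of prime power order forces the group order to be a
prime power. -/
theorem PowTwin.isPrimePow_card {x : G} (hx1 : x ≠ 1) (hx : PowTwin x 1)
    (hpp : IsPrimePow (orderOf x)) : IsPrimePow (Nat.card G) := by
  obtain ⟨p, s, hp, hs, hps⟩ := hpp
  replace hp := hp.nat_prime
  have hcard : Nat.card G = p ^ (Nat.card G).primeFactorsList.length := by
    refine Nat.eq_prime_pow_of_unique_prime_dvd Nat.card_pos.ne' fun {q} hq hqG ↦ ?_
    have := Fact.mk hq
    obtain ⟨u, hu⟩ := exists_prime_orderOf_dvd_card' q hqG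
    rcases powTwin_one_iff.mp hx u with h | h
    · have h' := orderOf_dvd_of_mem_zpowers h
      rw [hu, ← hps] at h'
      exact ((Nat.prime_dvd_prime_iff_eq hp hq).mp ((dvd_pow_self p hs.ne').trans h')).symm
    · have h' := orderOf_dvd_of_mem_zpowers h
      rw [hu, ← hps] at h'
      exact (Nat.prime_dvd_prime_iff_eq hq hp).mp (hq.dvd_of_dvd_pow h')
  rw [hcard]
  refine hp.isPrimePow.pow fun h0 ↦ hx1 ?_
  rw [h0, pow_zero, Nat.card_eq_one_iff_unique] at hcard
  exact hcard.1.elim _ _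

/-- The offending element generates `G`, so `|G| = |H|` is not a prime power. Then a non-identity
dominating element of `H`, namely `f x` or, if `f x = 1`, `f 1`, cannot have prime power order and
generates `H`. -/
theorem nonempty_mulEquiv_of_not_primePowDominating (hG : ¬ PrimePowDominating G) (f : G ≃ H)
    (hf : ∀ x y, PowComparable (f x) (f y) ↔ PowComparable x y) : Nonempty (G ≃* H) := by
  unfold PrimePowDominating at hG
  push Not at hG
  obtain ⟨x, hx1, hx, hpp⟩ := hG
  have hgen := hx.mem_zpowers_of_not_isPrimePow hx1 hpp
  have hcard := Nat.card_congr f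
  rw [orderOf_eq_card_of_forall_mem_zpowers hgen, hcard] at hpp
  obtain ⟨u, hu1, hu⟩ : ∃ u : H, u ≠ 1 ∧ PowTwin u 1 := by
    by_cases h : f x = 1
    · refine ⟨f 1, fun h' ↦ hx1 (f.injective (h.trans h'.symm)), ?_⟩
      exact (powTwin_map_one_iff f hf).mpr (.refl 1)
    · exact ⟨f x, h, (powTwin_map_one_iff f hf).mpr hx⟩
  have hgen' := hu.mem_zpowers_of_not_isPrimePow hu1 fun h ↦ hpp (hu.isPrimePow_card hu1 h)
  have : IsCyclic G := ⟨x, hgen⟩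
  have : IsCyclic H := ⟨u, hgen'⟩
  exact ⟨mulEquivOfCyclicCardEq hcard⟩

theorem exists_pos_pow_eq_iff {x y : G} : (∃ m : ℕ, 0 < m ∧ y = x ^ m) ↔ y ∈ zpowers x := by
  refine ⟨fun ⟨m, _, h⟩ ↦ h ▸ npow_mem_zpowers x m, fun h ↦ ?_⟩
  obtain ⟨m, rfl⟩ := mem_powers_iff_mem_zpowers.mpr h
  -- Adding `orderOf x` makes the exponent positive even when `m = 0`.
  exact ⟨m + orderOf x, by have := orderOf_pos x; omega, by simp [pow_add, pow_orderOf_eq_one]⟩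

theorem powComparable_iff_eq_or_adj {x y : G} :
    PowComparable x y ↔ x = y ∨ (powerGraph G).Adj x y := by
  unfold PowComparable
  rw [← exists_pos_pow_eq_iff, ← exists_pos_pow_eq_iff, ← exists_or]
  simp only [← and_or_left]
  refine ⟨fun h ↦ or_iff_not_imp_left.mpr fun hne ↦ ⟨hne, h⟩, ?_⟩
  rintro (rfl | h)
  · exact ⟨1, one_pos, by simp⟩
  · exact h.2

end Transfer

theorem mainTheorem2 {G₁ : Type*} {G₂ : Type*} [Group G₁] [Group G₂] [Finite G₁] [Finite G₂]
    (h : Nonempty (SimpleGraph.Iso (powerGraph G₁) (powerGraph G₂))) :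
    Nonempty (DigraphIso (directedPowerGraph G₁) (directedPowerGraph G₂)) := by
  obtain ⟨φ⟩ := h
  have hf : ∀ x y, PowComparable (φ.toEquiv x) (φ.toEquiv y) ↔ PowComparable x y := fun x y ↦ by
    rw [powComparable_iff_eq_or_adj, powComparable_iff_eq_or_adj]
    exact or_congr φ.toEquiv.apply_eq_iff_eq φ.map_adj_iff
  suffices H : ∃ g : G₁ ≃ G₂, ∀ x y, g x ∈ zpowers (g y) ↔ x ∈ zpowers y by
    obtain ⟨g, hg⟩ := H
    refine ⟨⟨g, fun {x y} ↦ ?_⟩⟩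
    exact and_congr (not_congr g.apply_eq_iff_eq)
      (exists_pos_pow_eq_iff.trans ((hg y x).trans exists_pos_pow_eq_iff.symm))
  have of_mulEquiv (e : G₁ ≃* G₂) : ∃ g : G₁ ≃ G₂, ∀ x y, g x ∈ zpowers (g y) ↔ x ∈ zpowers y := by
    refine ⟨e.toEquiv, fun x y ↦ ?_⟩
    change e x ∈ zpowers (e y) ↔ _
    simp only [mem_zpowers_iff, ← map_zpow, e.apply_eq_iff_eq]
  by_cases h₁ : PrimePowDominating G₁
  · by_cases h₂ : PrimePowDominating G₂
    · exact exists_equiv_mem_zpowers_iff h₁ h₂ φ.toEquiv hf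
    · obtain ⟨e⟩ := nonempty_mulEquiv_of_not_primePowDominating h₂ φ.toEquiv.symm fun x y ↦ by
        rw [← hf]; simp
      exact of_mulEquiv e.symm
  · obtain ⟨e⟩ := nonempty_mulEquiv_of_not_primePowDominating h₁ φ.toEquiv hf
    exact of_mulEquiv e
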